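/- **Corollary 3.2 (Robust (one-sided) determination).** Let $\mathcal H$ be a real Hilbert space. For a continuous convex function $h\colon\mathcal H\to\mathbb R$ and $x\in\mathcal H$ let $$\partial h(x)=\{v\in\mathcal H:\ h(y)-h(x)\ge\langle v,y-x\rangle\ \text{ for all } y\in\mathcal H\},\qquad s_h(x)=\operatorname{dist}(0,\partial h(x))$$ be its subdifferential and its slope at $x$. For $\omega\colon\mathcal H\to\mathbb R$ and $\mathcal U\subset\mathcal H$ put $$\|\omega|_{\mathcal U}:=\sup_{x\in\mathcal U}\,\max\{\omega(x),0\}\in[0,+\infty],$$ the supremum over the empty set being $0$. Let $f$ and $f_k$ $(k\ge 0)$ be continuous convex functions from $\mathcal H$ to $\mathbb R$, and suppose that the set of minimizers $C_f=\operatorname{arg\,min} f$ is nonempty and bounded. Assume that 1. $\limsup_{k\to\infty}\|s_{f_k}-s_f|_{\mathcal U}\le 0$ for all bounded sets $\mathcal U\subset\mathcal H$, and 2. $\limsup_{k\to\infty}\|f_k-f|_{C_f}\le 0$. Then $\limsup_{k\to\infty}\|f_k-f|_{\mathcal U}\le 0$ for all bounded sets $\mathcal U\subset\mathcal H$. -/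

import Mathlib

noncomputable section

namespace SlopeDet

/-- The convex subdifferential `∂f(x)` of a function on a real inner product space. -/
def subdifferential {H : Type*} [NormedAddCommGroup H] [InnerProductSpace ℝ H]
    (f : H → ℝ) (x : H) : Set H :=
  {v | ∀ y, inner ℝ v (y - x) ≤ f y - f x}

/-- The slope `s_f(x) = dist(0, ∂f(x))`, a real number. For a continuous convex `f : H → ℝ` the set
`∂f(x)` is nonempty, so the value that `Metric.infDist` takes on the empty set plays no role. -/
def slope {H : Type*} [NormedAddCommGroup H] [InnerProductSpace ℝ H]
    (f : H → ℝ) (x : H) : ℝ :=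
  Metric.infDist 0 (subdifferential f x)

/-- The set `C_f = argmin f` of global minimizers. -/
def minimizers {H : Type*} (f : H → ℝ) : Set H :=
  {x | ∀ y, f x ≤ f y}

/-- The one-sided supremum of `ω` over `U`, that is `sup_{x ∈ U} max {ω x, 0}`, taken in `[0, ∞]`
(it is `∞` if `ω` is not bounded above on `U`); note that `ENNReal.ofReal r` is `max r 0`. -/
def oneSidedSup {H : Type*} (ω : H → ℝ) (U : Set H) : ENNReal :=
  ⨆ x ∈ U, ENNReal.ofReal (max (ω x) 0)

end SlopeDet

end

/-!
Fix a minimizer `c` of `f` and write `g` for one of the `f_k`. The comparison of `g - f` at `x` with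
its value at `c` rests on a comparison principle (`exists_slope_le_max`): for convex `φ` with
minimizer `c` and any `δ > 0`, one can go from `x` to a point `y`, no farther from `c`, at which
`g - φ` has not decreased and `s_φ y ≤ max (s_g y) δ`. It plays the role of following the steepest
descent curve of `φ`: convexity of `g` gives `g y - g z ≤ s_g y * ‖y - z‖`, so as long as
`s_φ y > max (s_g y) δ` there is a further `z` that decreases `φ` by more than `g` and by more than
`δ * ‖y - z‖`; an Ekeland-type maximality argument (`exists_maximal_of_mul_dist_le`) then produces
the end point. That the steps do not increase the distance to `c` comes from the Hahn-Banach
sandwich theorem (`exists_subgradient_of_concave_le`, `slope_le_of_le_add_mul_norm`).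

Suppose `s_g ≤ s_f + ε` on the ball of radius `D` around `c`. The principle is used twice.
* By continuity `f ≤ K` on a ball of radius `r` around `c`, so where `f > K` each subgradient `v`
  satisfies `⟪v, y - c⟫ ≥ r * ‖v‖`, and `φ = f + (ε / r) * ‖· - c‖ ^ 2` has slope at least
  `s_f + 2 * ε` there (`slope_add_le_slope_add_sq`). Hence the end point lies in `{f ≤ K}`. This
  part is what makes the estimate uniform on bounded sets, on which `f` need not be bounded when
  `H` is infinite dimensional.
* From there, `φ = (1 + η) * f` leads to a point `z` where `s_f z ≤ ε / η`. Then `s_g z` is small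
  too, and convexity of `g` bounds `g z - g c` by `(ε / η + ε) * D`, whereas `f z ≥ f c`.

The resulting estimate `sub_le_of_slope_le` tends to zero on taking `ε = η ^ 2` and `η → 0`.
-/

open Filter Topology

namespace SlopeDet

variable {H : Type*} [NormedAddCommGroup H] [InnerProductSpace ℝ H]

/-! ### Subgradients and slopes -/

/-- Sandwich theorem: if a concave function `ψ` on `s` lies below `φ` and touches it at `y`, then
some affine function through `(y, φ y)` lies between them. It is obtained by separating the strict
epigraph of `φ` from the hypograph of `ψ`. -/
theorem exists_subgradient_of_concave_le [CompleteSpace H] {φ ψ : H → ℝ} {s : Set H} {y : H}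
    (hφ : ConvexOn ℝ Set.univ φ) (hφc : Continuous φ) (hψ : ConcaveOn ℝ s ψ) (hy : y ∈ s)
    (hyy : ψ y = φ y) (hle : ∀ z ∈ s, ψ z ≤ φ z) :
    ∃ v ∈ subdifferential φ y, ∀ z ∈ s, ψ z ≤ φ y + inner ℝ v (z - y) := by
  have hconv : Convex ℝ {p : H × ℝ | φ p.1 < p.2} := by
    simpa using hφ.convex_strict_epigraph
  have hopen : IsOpen {p : H × ℝ | φ p.1 < p.2} :=
    isOpen_lt (hφc.comp continuous_fst) continuous_snd
  have hdisj : Disjoint {p : H × ℝ | φ p.1 < p.2} {p : H × ℝ | p.1 ∈ s ∧ p.2 ≤ ψ p.1} := by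
    rw [Set.disjoint_left]
    rintro ⟨z, t⟩ h1 ⟨h2, h3⟩
    simp only [Set.mem_ofPred_eq] at h1 h2 h3
    linarith [hle z h2]
  obtain ⟨F, u, hF1, hF2⟩ := geometric_hahn_banach_open hconv hopen hψ.convex_hypograph hdisj
  set ℓ : StrongDual ℝ H := F.comp (ContinuousLinearMap.inl ℝ H ℝ) with hℓ
  set α : ℝ := F (0, 1) with hα
  have hF : ∀ z t, F (z, t) = ℓ z + t * α := by
    intro z t
    have : ((z, t) : H × ℝ) = (z, 0) + t • (0, 1) := by simp
    rw [this, map_add, map_smul, smul_eq_mul]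
    rfl
  have hlow : ∀ z ∈ s, u ≤ ℓ z + ψ z * α := fun z hz => by
    have := hF2 (z, ψ z) ⟨hz, le_rfl⟩
    rwa [hF] at this
  have hup : ∀ z t, φ z < t → ℓ z + t * α < u := fun z t ht => by
    have := hF1 (z, t) ht
    rwa [hF] at this
  have huy := hlow y hy
  rw [hyy] at huy
  have hneg : α < 0 := by
    have := hup y (φ y + 1) (by linarith)
    linarith
  have hup' : ∀ z, ℓ z + φ z * α ≤ u := by
    intro z
    have hlim : Tendsto (fun t : ℝ => ℓ z + t * α) (𝓝[>] (φ z)) (𝓝 (ℓ z + φ z * α)) :=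
      (Continuous.tendsto (by fun_prop) _).mono_left nhdsWithin_le_nhds
    refine le_of_tendsto hlim ?_
    filter_upwards [self_mem_nhdsWithin] with t ht using (hup z t ht).le
  have hin : ∀ z, inner ℝ ((InnerProductSpace.toDual ℝ H).symm ((-α)⁻¹ • ℓ)) (z - y)
      = (ℓ z - ℓ y) / (-α) := by
    intro z
    rw [InnerProductSpace.toDual_symm_apply]
    simp [div_eq_inv_mul]
  refine ⟨(InnerProductSpace.toDual ℝ H).symm ((-α)⁻¹ • ℓ), fun z => ?_, fun z hz => ?_⟩
  · rw [hin, div_le_iff₀ (by linarith)]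
    linarith [hup' z]
  · rw [hin, ← sub_le_iff_le_add', le_div_iff₀ (by linarith)]
    linarith [hlow z hz, hup' y]

theorem subdifferential_nonempty [CompleteSpace H] {g : H → ℝ}
    (hg : ConvexOn ℝ Set.univ g) (hgc : Continuous g) (x : H) :
    (subdifferential g x).Nonempty := by
  obtain ⟨v, hv, -⟩ := exists_subgradient_of_concave_le (s := {x}) (ψ := g) (y := x) hg hgc
    ((concaveOn_const (g x) (convex_singleton x)).congr (by intro z hz; rw [hz])) rfl rfl
    (fun z _ => le_rfl)
  exact ⟨v, hv⟩

theorem slope_le_norm {φ : H → ℝ} {x v : H} (hv : v ∈ subdifferential φ x) :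
    slope φ x ≤ ‖v‖ := by
  simpa [slope] using Metric.infDist_le_dist_of_mem (x := (0 : H)) hv

theorem le_slope [CompleteSpace H] {φ : H → ℝ} (hφ : ConvexOn ℝ Set.univ φ) (hφc : Continuous φ)
    {x : H} {m : ℝ} (h : ∀ v ∈ subdifferential φ x, m ≤ ‖v‖) : m ≤ slope φ x := by
  refine (Metric.le_infDist (subdifferential_nonempty hφ hφc x)).2 fun v hv => ?_
  simpa using h v hv

/-- The decrease of a convex function is at most slope times distance, without restriction to a
neighbourhood of `x`. -/
theorem sub_le_slope_mul_norm [CompleteSpace H] {g : H → ℝ} (hg : ConvexOn ℝ Set.univ g)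
    (hgc : Continuous g) (x z : H) : g x - g z ≤ slope g x * ‖x - z‖ := by
  rcases eq_or_ne x z with rfl | hne
  · simp
  have hpos : 0 < ‖x - z‖ := norm_pos_iff.2 (sub_ne_zero.2 hne)
  rw [← div_le_iff₀ hpos]
  refine le_slope hg hgc fun v hv => ?_
  rw [div_le_iff₀ hpos]
  have h1 := hv z
  have h2 := real_inner_le_norm v (x - z)
  rw [← neg_sub x z, inner_neg_right] at h1
  linarith

/-- The slope at `y` is already bounded by the rate of decrease towards points that are no farther
from the minimizer `c` than `y`: moving from `y` along minus a subgradient does not increase the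
distance to `c`. -/
theorem slope_le_of_le_add_mul_norm [CompleteSpace H] {φ : H → ℝ} (hφ : ConvexOn ℝ Set.univ φ)
    (hφc : Continuous φ) {c y : H} (hc : c ∈ minimizers φ) {m : ℝ} (hm : 0 ≤ m)
    (h : ∀ z, ‖z - c‖ ≤ ‖y - c‖ → φ y ≤ φ z + m * ‖z - y‖) : slope φ y ≤ m := by
  rcases (hc y).eq_or_lt with heq | hlt
  · have h0 : (0 : H) ∈ subdifferential φ y := fun z => by
      have := hc z
      simp only [inner_zero_left]
      linarith
    simpa using (slope_le_norm h0).trans (by simpa using hm)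
  have hψ : ConcaveOn ℝ (Metric.closedBall c ‖y - c‖) (fun z => φ y - m * ‖z - y‖) := by
    have h1 : ConvexOn ℝ (Metric.closedBall c ‖y - c‖) (fun z => m * ‖z - y‖) := by
      simpa [dist_eq_norm] using (convexOn_dist y (convex_closedBall c ‖y - c‖)).smul hm
    exact (concaveOn_const (φ y) (convex_closedBall c ‖y - c‖)).sub h1
  obtain ⟨v, hv, hvs⟩ := exists_subgradient_of_concave_le hφ hφc hψ
    (y := y) (by simp [dist_eq_norm]) (by simp)
    (fun z hz => by
      have := h z (by simpa [dist_eq_norm] using hz)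
      linarith)
  refine (slope_le_norm hv).trans ?_
  have hpos : 0 < inner ℝ v (y - c) := by
    have := hv c
    rw [← neg_sub y c, inner_neg_right] at this
    linarith
  have hv0 : 0 < ‖v‖ := by
    refine norm_pos_iff.2 ?_
    rintro rfl
    simp at hpos
  -- For this `τ` the point `y - τ • v` stays in the ball.
  set τ : ℝ := inner ℝ v (y - c) / ‖v‖ ^ 2 with hτ
  have hτ0 : 0 < τ := by positivity
  have hball : ‖y - τ • v - c‖ ≤ ‖y - c‖ := by
    refine (sq_le_sq₀ (norm_nonneg _) (norm_nonneg _)).1 ?_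
    have h1 : y - τ • v - c = (y - c) - τ • v := by abel
    have h2 : τ * ‖v‖ ^ 2 = inner ℝ v (y - c) := by
      rw [hτ]; field_simp
    rw [h1, norm_sub_sq_real, inner_smul_right, real_inner_comm, norm_smul, mul_pow,
      Real.norm_eq_abs, sq_abs]
    nlinarith
  have := hvs (y - τ • v) (by simpa [dist_eq_norm] using hball)
  rw [sub_sub_cancel_left, norm_neg, norm_smul, Real.norm_eq_abs, abs_of_pos hτ0, inner_neg_right,
    inner_smul_right, real_inner_self_eq_norm_sq] at this
  have h3 : (τ * ‖v‖) * ‖v‖ ≤ (τ * ‖v‖) * m := by nlinarith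
  exact le_of_mul_le_mul_left h3 (by positivity)

/-! ### The comparison principle -/

/-- Ekeland-type principle: a closed preorder along which `φ`, bounded below, decreases by at least
`δ` times the distance has a maximal element above every point. -/
theorem exists_maximal_of_mul_dist_le {X : Type*} [MetricSpace X] [CompleteSpace X] {φ : X → ℝ}
    (hφ : Continuous φ) (hb : BddBelow (Set.range φ)) {δ : ℝ} (hδ : 0 < δ) {R : X → X → Prop}
    (hrefl : ∀ x, R x x) (htrans : ∀ x y z, R x y → R y z → R x z)
    (hclosed : ∀ x, IsClosed {y | R x y}) (hdesc : ∀ x y, R x y → δ * dist x y ≤ φ x - φ y)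
    (x : X) : ∃ y, R x y ∧ ∀ z, R y z → z = y := by
  have hbd : ∀ x, BddBelow (φ '' {y | R x y}) := fun x => hb.mono (Set.image_subset_range _ _)
  have hstep : ∀ (n : ℕ) (x : X), ∃ y, R x y ∧ ∀ z, R x z → φ y ≤ φ z + (1 / 2) ^ n := by
    intro n x
    obtain ⟨_, ⟨y, hy, rfl⟩, hlt⟩ := Real.lt_sInf_add_pos (s := φ '' {y | R x y})
      ⟨_, x, hrefl x, rfl⟩ (show (0 : ℝ) < (1 / 2) ^ n by positivity)
    exact ⟨y, hy, fun z hz => hlt.le.trans (by gcongr; exact csInf_le (hbd x) ⟨z, hz, rfl⟩)⟩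
  -- Each step nearly minimizes `φ` over the points above the current one.
  choose next hnext hmin using hstep
  let u : ℕ → X := fun n => Nat.rec x next n
  have hR : ∀ m n, m ≤ n → R (u m) (u n) := by
    intro m n hmn
    induction n, hmn using Nat.le_induction with
    | base => exact hrefl _
    | succ n _ ih => exact htrans _ _ _ ih (hnext n (u n))
  have hpow : Tendsto (fun n : ℕ => ((1 : ℝ) / 2) ^ n) atTop (𝓝 0) :=
    tendsto_pow_atTop_nhds_zero_of_lt_one (by norm_num) (by norm_num)
  have hanti : Antitone fun n => φ (u n) := fun m n hmn => by
    have := hdesc _ _ (hR m n hmn)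
    have : 0 ≤ δ * dist (u m) (u n) := by positivity
    simp only
    linarith
  have hlim := tendsto_atTop_ciInf hanti (hb.mono (by rintro _ ⟨n, rfl⟩; exact ⟨_, rfl⟩))
  have hcau : CauchySeq u := by
    set L := ⨅ n, φ (u n)
    have hL : ∀ n, L ≤ φ (u n) := fun n => hanti.le_of_tendsto hlim n
    refine cauchySeq_of_le_tendsto_0' (fun n => (φ (u n) - L) / δ) (fun m n hmn => ?_) ?_
    · rw [le_div_iff₀ hδ]
      linarith [hdesc _ _ (hR m n hmn), hL n]
    · simpa using (hlim.sub_const L).div_const δ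
  obtain ⟨y, hy⟩ := cauchySeq_tendsto_of_complete hcau
  have hRy : ∀ n, R (u n) y := fun n =>
    (hclosed (u n)).mem_of_tendsto hy (eventually_atTop.2 ⟨n, fun m hm => hR n m hm⟩)
  refine ⟨y, hRy 0, fun z hz => ?_⟩
  have h1 : φ y ≤ φ z := by
    have h2 : Tendsto (fun n => φ z + ((1 : ℝ) / 2) ^ n) atTop (𝓝 (φ z)) := by
      simpa using hpow.const_add (φ z)
    refine le_of_tendsto_of_tendsto' (((hφ.tendsto y).comp hy).comp (tendsto_add_atTop_nat 1)) h2
      fun n => hmin n (u n) z (htrans _ _ _ (hRy n) hz)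
  have h3 := hdesc y z hz
  have h4 : dist y z ≤ 0 := by
    by_contra! h
    have := mul_pos hδ h
    linarith
  exact (dist_le_zero.1 h4).symm

/-- Comparison principle: the substitute for following the steepest descent curve of `φ` from `x`
until its slope is at most `max (slope g y) δ`. -/
theorem exists_slope_le_max [CompleteSpace H] {φ g : H → ℝ} (hφ : ConvexOn ℝ Set.univ φ)
    (hφc : Continuous φ) (hg : ConvexOn ℝ Set.univ g) (hgc : Continuous g) {c : H}
    (hc : c ∈ minimizers φ) {δ : ℝ} (hδ : 0 < δ) (x : H) :
    ∃ y, ‖y - c‖ ≤ ‖x - c‖ ∧ φ y ≤ φ x ∧ g x - φ x ≤ g y - φ y ∧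
      slope φ y ≤ max (slope g y) δ := by
  obtain ⟨y, ⟨h1, h2, h3⟩, hmax⟩ := exists_maximal_of_mul_dist_le hφc
    ⟨φ c, by rintro _ ⟨z, rfl⟩; exact hc z⟩ hδ
    (R := fun x y => ‖y - c‖ ≤ ‖x - c‖ ∧ g x - φ x ≤ g y - φ y ∧ δ * dist x y ≤ φ x - φ y)
    (fun x => by simp)
    (fun x y z ⟨a1, a2, a3⟩ ⟨b1, b2, b3⟩ => ⟨b1.trans a1, a2.trans b2, by
      nlinarith [dist_triangle x y z]⟩)
    (fun x => by
      simp only [Set.ofPred_and]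
      refine (isClosed_le (by fun_prop) (by fun_prop)).inter
        ((isClosed_le (by fun_prop) (by fun_prop)).inter
          (isClosed_le (by fun_prop) (by fun_prop))))
    (fun x y h => h.2.2) x
  have hδd : 0 ≤ δ * dist x y := by positivity
  refine ⟨y, h1, by linarith, h2, slope_le_of_le_add_mul_norm hφ hφc hc
    (hδ.le.trans (le_max_right _ _)) fun z hz => ?_⟩
  by_contra! hlt
  have hs : slope g y * ‖z - y‖ ≤ max (slope g y) δ * ‖z - y‖ := by
    gcongr; exact le_max_left _ _
  have hd : δ * ‖z - y‖ ≤ max (slope g y) δ * ‖z - y‖ := by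
    gcongr; exact le_max_right _ _
  have hgz := sub_le_slope_mul_norm hg hgc y z
  rw [norm_sub_rev] at hgz
  have := hmax z ⟨hz, by linarith, by rw [dist_comm, dist_eq_norm]; linarith⟩
  subst this
  simp at hlt

/-! ### Slopes of perturbed functions -/

/-- Sum rule for a convex function plus a multiple of a squared distance. -/
theorem sub_mem_subdifferential {f : H → ℝ} (hf : ConvexOn ℝ Set.univ f) {a : ℝ} {c y w : H}
    (hw : w ∈ subdifferential (fun x => f x + a * ‖x - c‖ ^ 2) y) :
    w - (2 * a) • (y - c) ∈ subdifferential f y := by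
  intro z
  have key : ∀ t ∈ Set.Ioo (0 : ℝ) 1,
      inner ℝ (w - (2 * a) • (y - c)) (z - y) ≤ f z - f y + t * (a * ‖z - y‖ ^ 2) := by
    rintro t ⟨ht0, ht1⟩
    have h1 := hw (y + t • (z - y))
    have h2 : f (y + t • (z - y)) ≤ (1 - t) * f y + t * f z := by
      have := hf.2 (Set.mem_univ y) (Set.mem_univ z) (sub_nonneg.2 ht1.le) ht0.le (by ring)
      rwa [show (1 - t) • y + t • z = y + t • (z - y) by module] at this
    have h3 : y + t • (z - y) - c = (y - c) + t • (z - y) := by abel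
    simp only [h3] at h1
    rw [add_sub_cancel_left, norm_add_sq_real, inner_smul_right, inner_smul_right, norm_smul,
      mul_pow, Real.norm_eq_abs, sq_abs] at h1
    rw [inner_sub_left, real_inner_smul_left]
    refine le_of_mul_le_mul_left ?_ ht0
    nlinarith
  have hlim : Tendsto (fun t : ℝ => f z - f y + t * (a * ‖z - y‖ ^ 2)) (𝓝[>] 0)
      (𝓝 (f z - f y)) := by
    have : Continuous fun t : ℝ => f z - f y + t * (a * ‖z - y‖ ^ 2) := by fun_prop
    simpa using (this.tendsto 0).mono_left nhdsWithin_le_nhds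
  exact ge_of_tendsto hlim
    (by filter_upwards [Ioo_mem_nhdsGT (zero_lt_one' ℝ)] with t ht using key t ht)

/-- Where `f` is at least its bound on the ball of radius `r` around `c`, subgradients make an angle
with `y - c` that is bounded away from a right angle. -/
theorem mul_norm_le_inner_of_mem_subdifferential {f : H → ℝ} {c y v : H} {r K : ℝ}
    (hr : 0 ≤ r) (hK : ∀ z, ‖z - c‖ ≤ r → f z ≤ K) (hy : K ≤ f y)
    (hv : v ∈ subdifferential f y) : r * ‖v‖ ≤ inner ℝ v (y - c) := by
  rcases eq_or_ne v 0 with rfl | hv0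
  · simp
  have hn : 0 < ‖v‖ := norm_pos_iff.2 hv0
  have h1 := hv (c + (r / ‖v‖) • v)
  have h2 := hK (c + (r / ‖v‖) • v) (by
    rw [add_sub_cancel_left, norm_smul, Real.norm_eq_abs, abs_of_nonneg (by positivity)]
    field_simp
    exact le_rfl)
  have h3 : c + (r / ‖v‖) • v - y = (r / ‖v‖) • v - (y - c) := by abel
  have h4 : r / ‖v‖ * ‖v‖ ^ 2 = r * ‖v‖ := by field_simp
  rw [h3, inner_sub_right, inner_smul_right, real_inner_self_eq_norm_sq, h4] at h1
  linarith

theorem convexOn_add_mul_norm_sq {f : H → ℝ} (hf : ConvexOn ℝ Set.univ f) (c : H) {a : ℝ}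
    (ha : 0 ≤ a) : ConvexOn ℝ Set.univ fun x => f x + a * ‖x - c‖ ^ 2 := by
  have h1 : ConvexOn ℝ Set.univ fun x => ‖x - c‖ ^ 2 := by
    simp only [← dist_eq_norm]
    exact (convexOn_dist c convex_univ).pow (fun x _ => dist_nonneg) 2
  exact hf.add (h1.smul ha)

/-- Outside the sublevel set `{f ≤ K}` the quadratic perturbation raises the slope by a fixed amount,
by the angle condition of `mul_norm_le_inner_of_mem_subdifferential`. -/
theorem slope_add_le_slope_add_sq [CompleteSpace H] {f : H → ℝ} (hf : ConvexOn ℝ Set.univ f)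
    (hfc : Continuous f) {c y : H} {r K ε : ℝ} (hr : 0 < r) (hε : 0 ≤ ε)
    (hK : ∀ z, ‖z - c‖ ≤ r → f z ≤ K) (hy : K < f y) :
    slope f y + 2 * ε ≤ slope (fun x => f x + ε / r * ‖x - c‖ ^ 2) y := by
  refine le_slope (convexOn_add_mul_norm_sq hf c (by positivity)) (by fun_prop) fun w hw => ?_
  have hv := sub_mem_subdifferential hf hw
  set v := w - (2 * (ε / r)) • (y - c) with hvdef
  have hwv : w = v + (2 * (ε / r)) • (y - c) := by rw [hvdef]; abel
  have hang := mul_norm_le_inner_of_mem_subdifferential hr.le hK hy.le hv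
  have hv0 : 0 < ‖v‖ := by
    refine norm_pos_iff.2 fun h0 => ?_
    have := hv c
    rw [h0, inner_zero_left] at this
    linarith [hK c (by simpa using hr.le)]
  have h1 : ‖v‖ ^ 2 + 2 * ε * ‖v‖ ≤ inner ℝ v w := by
    rw [hwv, inner_add_right, inner_smul_right, real_inner_self_eq_norm_sq]
    have : 2 * (ε / r) * (r * ‖v‖) ≤ 2 * (ε / r) * inner ℝ v (y - c) := by gcongr
    have e : 2 * (ε / r) * (r * ‖v‖) = 2 * ε * ‖v‖ := by field_simp
    linarith
  have h2 : ‖v‖ + 2 * ε ≤ ‖w‖ := by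
    refine le_of_mul_le_mul_left ?_ hv0
    linarith [real_inner_le_norm v w]
  linarith [slope_le_norm hv]

theorem mul_slope_le_slope_const_mul [CompleteSpace H] {f : H → ℝ} (hf : ConvexOn ℝ Set.univ f)
    (hfc : Continuous f) {a : ℝ} (ha : 0 < a) (y : H) :
    a * slope f y ≤ slope (fun x => a * f x) y := by
  refine le_slope (hf.smul ha.le) (by fun_prop) fun w hw => ?_
  have hv : a⁻¹ • w ∈ subdifferential f y := fun z => by
    have := hw z
    rw [real_inner_smul_left, inv_mul_le_iff₀ ha]
    simp only [smul_eq_mul] at this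
    linarith
  have := slope_le_norm hv
  rw [norm_smul, Real.norm_eq_abs, abs_of_pos (by positivity)] at this
  rwa [← le_inv_mul_iff₀ ha]

/-! ### The quantitative estimate and its limit -/

/-- Quantitative one-sided determination. The bound involves `f` only through `K`, `r` and `c`, and
not through its values on the ball of radius `D`. -/
theorem sub_le_of_slope_le [CompleteSpace H] {f g : H → ℝ} (hf : ConvexOn ℝ Set.univ f)
    (hfc : Continuous f) (hg : ConvexOn ℝ Set.univ g) (hgc : Continuous g) {c : H}
    (hc : c ∈ minimizers f) {r K D ε η : ℝ} (hr : 0 < r) (hε : 0 < ε) (hη : 0 < η)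
    (hK : ∀ z, ‖z - c‖ ≤ r → f z ≤ K) (hs : ∀ z, ‖z - c‖ ≤ D → slope g z ≤ slope f z + ε)
    {x : H} (hx : ‖x - c‖ ≤ D) :
    g x - f x ≤ g c - f c + ε / r * D ^ 2 + (ε / η + ε) * D + η * (K - f c) := by
  have hεr : 0 < ε / r := by positivity
  obtain ⟨y, hyc, -, hgy, hsy⟩ := exists_slope_le_max
    (φ := fun x => f x + ε / r * ‖x - c‖ ^ 2) (convexOn_add_mul_norm_sq hf c hεr.le) (by fun_prop) hg hgc
    (c := c) (fun z => by
      have := hc z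
      have : 0 ≤ ε / r * ‖z - c‖ ^ 2 := by positivity
      simp only [sub_self, norm_zero]
      linarith) hε x
  -- Above the level `K` the perturbed slope would exceed `slope g y` and `ε`.
  have hfy : f y ≤ K := by
    by_contra! hlt
    have h1 := slope_add_le_slope_add_sq hf hfc hr hε.le hK hlt
    have h2 := hs y (hyc.trans hx)
    have h3 : 0 ≤ slope f y := Metric.infDist_nonneg
    rcases max_choice (slope g y) ε with h | h <;> rw [h] at hsy <;> linarith
  obtain ⟨z, hzc, -, hgz, hsz⟩ := exists_slope_le_max (φ := fun x => (1 + η) * f x)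
    (hf.smul (by positivity : 0 ≤ 1 + η)) (by fun_prop) hg hgc
    (c := c) (fun z => mul_le_mul_of_nonneg_left (hc z) (by positivity)) hε y
  have hzD := hzc.trans (hyc.trans hx)
  have hsgz := hs z hzD
  have hsfz : slope f z ≤ ε / η := by
    rw [le_div_iff₀ hη]
    have h1 := mul_slope_le_slope_const_mul hf hfc (by positivity : 0 < 1 + η) z
    have h3 : 0 ≤ slope f z := Metric.infDist_nonneg
    rcases max_choice (slope g z) ε with h | h <;> rw [h] at hsz <;> linarith
  have h1 : g z - g c ≤ (ε / η + ε) * D :=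
    (sub_le_slope_mul_norm hg hgc z c).trans (by gcongr; linarith)
  have h2 : ε / r * ‖x - c‖ ^ 2 ≤ ε / r * D ^ 2 := by gcongr
  have h3 : 0 ≤ ε / r * ‖y - c‖ ^ 2 := by positivity
  have h4 : η * f y ≤ η * K := by gcongr
  have h5 : (1 + η) * f c ≤ (1 + η) * f z := by have := hc z; gcongr
  linarith

theorem limsup_oneSidedSup_le_zero_iff {X : Type*} {ω : ℕ → X → ℝ} {U : Set X} :
    limsup (fun k => oneSidedSup (ω k) U) atTop ≤ 0 ↔
      ∀ ε > 0, ∀ᶠ k in atTop, ∀ x ∈ U, ω k x ≤ ε := by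
  constructor
  · intro h ε hε
    have hlt : limsup (fun k => oneSidedSup (ω k) U) atTop < ENNReal.ofReal ε :=
      h.trans_lt (by simpa using hε)
    filter_upwards [eventually_lt_of_limsup_lt hlt] with k hk x hx
    have h1 : ENNReal.ofReal (max (ω k x) 0) ≤ oneSidedSup (ω k) U :=
      le_iSup₂ (f := fun x _ => ENNReal.ofReal (max (ω k x) 0)) x hx
    exact (le_max_left _ _).trans ((ENNReal.ofReal_le_ofReal_iff hε.le).1 (h1.trans hk.le))
  · intro h
    refine le_of_forall_pos_le_add fun ε hε => ?_
    rcases eq_or_ne ε ⊤ with rfl | htop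
    · simp
    have hpos : 0 < ε.toReal := ENNReal.toReal_pos hε.ne' htop
    rw [zero_add]
    refine limsup_le_of_le (by isBoundedDefault) ?_
    filter_upwards [h _ hpos] with k hk
    refine iSup₂_le fun x hx => ?_
    rw [← ENNReal.ofReal_toReal htop]
    exact ENNReal.ofReal_le_ofReal (max_le (hk x hx) hpos.le)

end SlopeDet

theorem corollary3p2 {H : Type*} [NormedAddCommGroup H] [InnerProductSpace ℝ H] [CompleteSpace H]
    (f : H → ℝ) (fseq : ℕ → H → ℝ)
    (hf_conv : ConvexOn ℝ Set.univ f) (hf_cont : Continuous f)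
    (hseq_conv : ∀ k, ConvexOn ℝ Set.univ (fseq k)) (hseq_cont : ∀ k, Continuous (fseq k))
    (hC_ne : (SlopeDet.minimizers f).Nonempty)
    (hC_bdd : Bornology.IsBounded (SlopeDet.minimizers f))
    (h_slope : ∀ U : Set H, Bornology.IsBounded U →
      Filter.limsup (fun k : ℕ => SlopeDet.oneSidedSup
        (fun x => SlopeDet.slope (fseq k) x - SlopeDet.slope f x) U) Filter.atTop ≤ 0)
    (h_min : Filter.limsup (fun k : ℕ => SlopeDet.oneSidedSup
        (fun x => fseq k x - f x) (SlopeDet.minimizers f)) Filter.atTop ≤ 0) :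
    ∀ U : Set H, Bornology.IsBounded U →
      Filter.limsup (fun k : ℕ => SlopeDet.oneSidedSup
        (fun x => fseq k x - f x) U) Filter.atTop ≤ 0 := by
  intro U hU
  obtain ⟨c, hc⟩ := hC_ne
  obtain ⟨D, hD0, hD⟩ := hU.subset_closedBall_lt 0 c
  obtain ⟨r, hr, hK⟩ : ∃ r > 0, ∀ z, ‖z - c‖ ≤ r → f z ≤ f c + 1 := by
    have h := hf_cont.continuousAt.eventually (gt_mem_nhds (lt_add_one (f c)))
    obtain ⟨r, hr, h⟩ := Metric.nhds_basis_closedBall.mem_iff.1 h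
    exact ⟨r, hr, fun z hz => (h (by simpa [dist_eq_norm] using hz)).le⟩
  rw [SlopeDet.limsup_oneSidedSup_le_zero_iff] at h_min ⊢
  intro θ hθ
  -- With slope error `η ^ 2` the error of `sub_le_of_slope_le` tends to zero with `η`.
  obtain ⟨η, hη, hηθ⟩ : ∃ η > 0,
      η ^ 2 + η ^ 2 / r * D ^ 2 + (η + η ^ 2) * D + η < θ := by
    have hcont : Continuous fun η : ℝ =>
        η ^ 2 + η ^ 2 / r * D ^ 2 + (η + η ^ 2) * D + η := by fun_prop
    have h := (hcont.tendsto 0).eventually (gt_mem_nhds (by simpa using hθ))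
    obtain ⟨η, h1, h2⟩ := ((h.filter_mono nhdsWithin_le_nhds).and
      (self_mem_nhdsWithin : Set.Ioi (0 : ℝ) ∈ 𝓝[>] 0)).exists
    exact ⟨η, h2, h1⟩
  have hη2 : 0 < η ^ 2 := by positivity
  filter_upwards [SlopeDet.limsup_oneSidedSup_le_zero_iff.1
    (h_slope _ (Metric.isBounded_closedBall (x := c) (r := D))) _ hη2, h_min _ hη2] with k hs hm x hx
  have h1 := SlopeDet.sub_le_of_slope_le hf_conv hf_cont (hseq_conv k) (hseq_cont k) hc hr hη2 hη hK
    (D := D) (fun z hz => by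
      have := hs z (by simpa [dist_eq_norm] using hz)
      linarith) (x := x) (by simpa [dist_eq_norm] using hD hx)
  have h2 := hm c hc
  have h3 : η ^ 2 / η = η := by field_simp
  rw [h3] at h1
  linarith
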